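/- Let $\Phi$ be a finite reduced crystallographic root system (spanning a subspace of a real vector space $M$, for instance the root system of a reductive group with respect to a maximal torus), with a base $\Delta$, positive roots $\Phi^+$ and Weyl group $W$. Let $\ell$ denote the Coxeter length on $W$ with respect to the simple reflections, i.e. $\ell(w)$ is the least number of simple reflections with product $w$. Let $\le$ be the (strong) Bruhat order on $W$, i.e. the partial order generated by $w< ws_\alpha$ for $\alpha\in\Phi^+$ with $\ell(w)<\ell(ws_\alpha)$, and write $[u,v]=\{w\in W : u\le w\le v\}$ for $u\le v$. The Bruhat graph has vertex set $W$ and edges $x\sim s_\alpha x$, with label $\alpha$, for $x\in W$ and $\alpha\in\Phi^+$. For $u\le v$ let $\mathrm{AD}(u,v)$ be the $\mathbb{R}$-span of the labels of all edges of the Bruhat graph with both endpoints in $[u,v]$, and let $\mathrm{ad}(u,v)=\dim_{\mathbb{R}}\mathrm{AD}(u,v)$ be the algebraic dimension of $[u,v]$. The interval $[u,v]$ is called toric if $\mathrm{ad}(u,v)=\ell(v)-\ell(u)$. Then for all $u\le v$ in $W$, \[ \mathrm{ad}(u,v)=\max\{\ell(w)-\ell(u) : w\in[u,v],\ [u,w]\text{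 is toric}\}, \] and dually \[ \mathrm{ad}(u,v)=\max\{\ell(v)-\ell(w) : w\in[u,v],\ [w,v]\text{ is toric}\}, \] where in particular both maxima are attained. -/

import Mathlib

noncomputable section

namespace RootPairing.Base

variable {ι M N : Type*} [AddCommGroup M] [Module ℝ M] [AddCommGroup N] [Module ℝ N]
  {P : RootPairing ι ℝ M N}

/-- The Coxeter length of `w`: the smallest number of simple reflections (of the base `b`) whose
product is `w`. -/
def weylLength (b : P.Base) (w : P.weylGroup) : ℕ :=
  sInf {n : ℕ | ∃ l : List b.support,
    l.length = n ∧ (l.map fun i => weylGroup.ofIdx P (i : ι)).prod = w}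

/-- The generating relations `w < w s_α` of the Bruhat order, for `α` a positive root with
`ℓ(w) < ℓ(w s_α)`. -/
def BruhatStep (b : P.Base) (w w' : P.weylGroup) : Prop :=
  ∃ i : ι, b.IsPos i ∧ w' = w * weylGroup.ofIdx P i ∧ b.weylLength w < b.weylLength w'

/-- The (strong) Bruhat order `u ≤ v` on the Weyl group: the reflexive and transitive relation
generated by `BruhatStep`. -/
def BruhatLE (b : P.Base) (u v : P.weylGroup) : Prop :=
  Relation.ReflTransGen b.BruhatStep u v

/-- The Bruhat interval `[u, v]`. -/
def bruhatInterval (b : P.Base) (u v : P.weylGroup) : Set P.weylGroup :=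
  {w | b.BruhatLE u w ∧ b.BruhatLE w v}

/-- The set of labels of the edges of the undirected Bruhat graph restricted to `[u, v]`: the edges
of the Bruhat graph are `x ∼ s_α x` for `α` a positive root, and such an edge has label `α`. -/
def edgeLabels (b : P.Base) (u v : P.weylGroup) : Set M :=
  {α | ∃ i : ι, b.IsPos i ∧ P.root i = α ∧ ∃ x ∈ b.bruhatInterval u v,
    weylGroup.ofIdx P i * x ∈ b.bruhatInterval u v}

/-- `AD(u, v)`: the real span of all edge labels of the Bruhat graph restricted to `[u, v]`. -/
def algebraicSpan (b : P.Base) (u v : P.weylGroup) : Submodule ℝ M :=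
  Submodule.span ℝ (b.edgeLabels u v)

/-- `ad(u, v)`: the algebraic dimension of the Bruhat interval `[u, v]`. -/
def algebraicDim (b : P.Base) (u v : P.weylGroup) : ℕ :=
  Module.finrank ℝ (b.algebraicSpan u v)

/-- The Bruhat interval `[u, v]` (where `u ≤ v`) is toric if `ad(u, v) = ℓ(v) - ℓ(u)`. -/
def IsToricInterval (b : P.Base) (u v : P.weylGroup) : Prop :=
  (b.algebraicDim u v : ℤ) = (b.weylLength v : ℤ) - (b.weylLength u : ℤ)

end RootPairing.Base

end

/-!
Why the maxima are attained. If `x < y = s_α x` is a cover in the Bruhat order, its label is `α`.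
All saturated chains from `u` to `v` have the same span of labels (`Chain.span_unique`). Indeed, for
a right descent `s` of `v`, the map `x ↦ min x (x s)` projects chains from `u` to `v` onto chains
from `min u (u s)` to `v s`, because right multiplication by `s` preserves every labelled edge that
it does not flip, and it changes the span of the labels in a way that depends on `u`, `v` and `s`
only (`Chain.lower_of_isDescent`, `Chain.lower_of_not_isDescent`). Since every upward edge refines
to a saturated chain (`IsPos.exists_chain`), and a chain from `x` to `s_α x` writes `s_α` as a
product of reflections in its labels, this common span is `AD(u, v)` (`Chain.algebraicSpan_eq`). In
particular `AD(u, v) = AD(u, c) + ℝ α` for every coatom `c` of `[u, v]`, with `α` the label of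
`c < v`, so that `ad(u, v) ≤ ℓ(v) - ℓ(u)`.

It remains to see that an interval `[u, v]` which is not toric has a coatom `c` such that
`AD(u, c) = AD(u, v)` (`finrank_eq_or_exists_cov`): passing to such coatoms repeatedly ends at a
toric interval `[u, w]` with `ad(u, w) = ad(u, v)`. Take any coatom `c`, and suppose that
`AD(u, c) ≠ AD(u, v)`. Then `[u, c]` is not toric either, and by induction it has a coatom `x` with
`AD(u, x) = AD(u, c)`. The interval `[x, v]` contains a second middle element `d`
(`Cover.exists_ne_cover`). If `AD(u, d) ≠ AD(u, v)`, then `AD(u, d) = AD(u, x)` for reasons of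
dimension, so the label of `x < d` lies both in `AD(u, x)` and in the plane spanned by the labels of
`x < c < v`, hence on the line of the label of `x < c`. The root system is reduced, so both labels
agree and `c = d`, which is absurd. The same argument, read upside down, gives the dual statement.

The upper bound is the monotonicity of `AD` in the interval.
-/

noncomputable section

namespace RootPairing.Base

variable {ι M N : Type*} [AddCommGroup M] [Module ℝ M] [AddCommGroup N] [Module ℝ N]
  {P : RootPairing ι ℝ M N}

section Length

/-! ### Reflections and words in the Weyl group -/

lemma weylGroup_ext {g h : P.weylGroup} (H : ∀ m : M, g • m = h • m) : g = h :=
  Subtype.ext <| Equiv.weightHom_injective P <| LinearEquiv.ext H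

lemma smul_sub_ofIdx_smul (i : ι) (m : M) :
    m - weylGroup.ofIdx P i • m ∈ Submodule.span ℝ {P.root i} := by
  rw [weylGroup.ofIdx_smul, Equiv.reflection_smul, reflection_apply, sub_sub_cancel]
  exact Submodule.smul_mem _ _ (Submodule.mem_span_singleton_self _)

@[simp] lemma ofIdx_smul_root (i : ι) : weylGroup.ofIdx P i • P.root i = -P.root i := by
  simp

@[simp] lemma ofIdx_mul_self (i : ι) : weylGroup.ofIdx P i * weylGroup.ofIdx P i = 1 :=
  weylGroup_ext fun m => by simp [mul_smul]

@[simp] lemma mul_ofIdx_mul_ofIdx (w : P.weylGroup) (i : ι) :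
    w * weylGroup.ofIdx P i * weylGroup.ofIdx P i = w := by
  simp [mul_assoc]

@[simp] lemma ofIdx_inv (i : ι) : (weylGroup.ofIdx P i)⁻¹ = weylGroup.ofIdx P i :=
  inv_eq_of_mul_eq_one_left (ofIdx_mul_self i)

@[simp] lemma weylGroupToPerm_ofIdx (i j : ι) :
    P.weylGroupToPerm (weylGroup.ofIdx P i) j = P.reflectionPerm i j := by
  apply P.root.injective
  rw [← weylGroup_apply_root]
  simp

lemma ofIdx_reflectionPerm (i j : ι) : weylGroup.ofIdx P (P.reflectionPerm j i) =
    weylGroup.ofIdx P j * weylGroup.ofIdx P i * weylGroup.ofIdx P j :=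
  weylGroup_ext fun m => by simp [mul_smul, reflection_reflectionPerm]

@[elab_as_elim]
lemma weylGroup_induction {p : P.weylGroup → Prop} (w : P.weylGroup)
    (ofIdx : ∀ i, p (weylGroup.ofIdx P i)) (one : p 1)
    (mul : ∀ x y, p x → p y → p (x * y)) : p w := by
  obtain ⟨w, hw⟩ := w
  exact weylGroup.induction P (pred := fun g hg => p ⟨g, hg⟩) ofIdx one
    (fun x y hx hy => mul ⟨x, hx⟩ ⟨y, hy⟩) hw

lemma ofIdx_weylGroupToPerm (w : P.weylGroup) (i : ι) :
    weylGroup.ofIdx P (P.weylGroupToPerm w i) = w * weylGroup.ofIdx P i * w⁻¹ := by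
  induction w using weylGroup_induction generalizing i with
  | ofIdx j => rw [weylGroupToPerm_ofIdx, ofIdx_reflectionPerm, ofIdx_inv]
  | one => simp
  | mul x y ihx ihy =>
    rw [map_mul, Equiv.Perm.mul_apply, ihx, ihy]
    group

lemma ofIdx_reflectionPerm_self (i : ι) :
    weylGroup.ofIdx P (P.reflectionPerm i i) = weylGroup.ofIdx P i := by
  simp [ofIdx_reflectionPerm]

lemma weylGroupToPerm_reflectionPerm_self (w : P.weylGroup) (i : ι) :
    P.weylGroupToPerm w (P.reflectionPerm i i) =
      P.reflectionPerm (P.weylGroupToPerm w i) (P.weylGroupToPerm w i) := by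
  apply P.root.injective
  rw [← weylGroup_apply_root]
  simp only [root_reflectionPerm, reflection_apply_self, smul_neg]
  rw [weylGroup_apply_root]

lemma isPos_reflectionPerm_self_iff (b : P.Base) (i : ι) :
    b.IsPos (P.reflectionPerm i i) ↔ ¬ b.IsPos i :=
  IsPos.neg_iff_not b i

variable [Finite ι] [P.IsCrystallographic] [P.IsReduced] (b : P.Base)

/-- The element of the Weyl group represented by a word in the simple reflections. -/
def wordProd (l : List b.support) : P.weylGroup :=
  (l.map fun i => weylGroup.ofIdx P (i : ι)).prod

omit [Finite ι] [P.IsCrystallographic] [P.IsReduced] in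
@[simp] lemma wordProd_nil : b.wordProd [] = 1 := rfl

omit [Finite ι] [P.IsCrystallographic] [P.IsReduced] in
@[simp] lemma wordProd_cons (i : b.support) (l : List b.support) :
    b.wordProd (i :: l) = weylGroup.ofIdx P (i : ι) * b.wordProd l := by
  simp [wordProd]

omit [Finite ι] [P.IsCrystallographic] [P.IsReduced] in
lemma wordProd_append (l l' : List b.support) :
    b.wordProd (l ++ l') = b.wordProd l * b.wordProd l' := by
  simp [wordProd]

lemma exists_wordProd_eq (w : P.weylGroup) : ∃ l, b.wordProd l = w := by
  induction w using weylGroup_induction with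
  | ofIdx i =>
    induction i using b.induction_reflect with
    | h₀ i h => rwa [ofIdx_reflectionPerm_self]
    | h₁ i h => exact ⟨[⟨i, h⟩], by simp⟩
    | h₂ i j h hj =>
      obtain ⟨l, hl⟩ := h
      exact ⟨⟨j, hj⟩ :: (l ++ [⟨j, hj⟩]), by
        simp [wordProd_append, hl, ofIdx_reflectionPerm, mul_assoc]⟩
  | one => exact ⟨[], rfl⟩
  | mul x y ihx ihy =>
    obtain ⟨l, hl⟩ := ihx
    obtain ⟨l', hl'⟩ := ihy
    exact ⟨l ++ l', by rw [wordProd_append, hl, hl']⟩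

/-- The strong exchange property: a word whose product makes the positive root `i` negative becomes,
after right multiplication with the reflection in `i`, the product of a word with one letter less.
-/
lemma exists_wordProd_eq_mul_ofIdx {i : ι} (hi : b.IsPos i) (l : List b.support)
    (hl : ¬ b.IsPos (P.weylGroupToPerm (b.wordProd l) i)) :
    ∃ l', l'.length + 1 = l.length ∧ b.wordProd l' = b.wordProd l * weylGroup.ofIdx P i := by
  induction l with
  | nil => simp [hi] at hl
  | cons j l ih =>
    by_cases h : b.IsPos (P.weylGroupToPerm (b.wordProd l) i)
    · -- The first letter makes a positive root negative, so that root is the simple root `j`.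
      have hj : P.weylGroupToPerm (b.wordProd l) i = j := by
        by_contra hne
        apply hl
        rw [wordProd_cons, map_mul, Equiv.Perm.mul_apply, weylGroupToPerm_ofIdx]
        exact h.reflectionPerm j.2 hne
      refine ⟨l, rfl, ?_⟩
      rw [wordProd_cons, ← hj, ofIdx_weylGroupToPerm]
      simp [mul_assoc]
    · obtain ⟨l', h₁, h₂⟩ := ih h
      exact ⟨j :: l', by simp [h₁], by simp [h₂, mul_assoc]⟩

/-! ### The length function -/

omit [Finite ι] [P.IsCrystallographic] [P.IsReduced] in
lemma weylLength_wordProd_le (l : List b.support) : b.weylLength (b.wordProd l) ≤ l.length :=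
  Nat.sInf_le ⟨l, rfl, rfl⟩

lemma exists_reduced_word (w : P.weylGroup) :
    ∃ l : List b.support, l.length = b.weylLength w ∧ b.wordProd l = w := by
  obtain ⟨l, hl⟩ := b.exists_wordProd_eq w
  exact Nat.sInf_mem (s := {n : ℕ | ∃ l : List b.support,
    l.length = n ∧ (l.map fun i => weylGroup.ofIdx P (i : ι)).prod = w}) ⟨_, l, rfl, hl⟩

lemma weylLength_mul_ofIdx_le (w : P.weylGroup) {j : ι} (hj : j ∈ b.support) :
    b.weylLength (w * weylGroup.ofIdx P j) ≤ b.weylLength w + 1 := by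
  obtain ⟨l, hl, rfl⟩ := b.exists_reduced_word w
  have := b.weylLength_wordProd_le (l ++ [⟨j, hj⟩])
  simpa [wordProd_append, hl] using this

variable {b}

lemma IsPos.weylLength_mul_ofIdx_lt {i : ι} (hi : b.IsPos i) {w : P.weylGroup}
    (hw : ¬ b.IsPos (P.weylGroupToPerm w i)) :
    b.weylLength (w * weylGroup.ofIdx P i) < b.weylLength w := by
  obtain ⟨l, hl, rfl⟩ := b.exists_reduced_word w
  obtain ⟨l', h₁, h₂⟩ := b.exists_wordProd_eq_mul_ofIdx hi l hw
  have := b.weylLength_wordProd_le l'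
  rw [h₂] at this
  lia

lemma IsPos.weylLength_lt_mul_ofIdx_iff {i : ι} (hi : b.IsPos i) {w : P.weylGroup} :
    b.weylLength w < b.weylLength (w * weylGroup.ofIdx P i) ↔
      b.IsPos (P.weylGroupToPerm w i) := by
  refine ⟨fun h => ?_, fun h => ?_⟩
  · by_contra h'
    exact (hi.weylLength_mul_ofIdx_lt h').not_gt h
  · have : ¬ b.IsPos (P.weylGroupToPerm (w * weylGroup.ofIdx P i) i) := by
      rwa [map_mul, Equiv.Perm.mul_apply, weylGroupToPerm_ofIdx,
        weylGroupToPerm_reflectionPerm_self, isPos_reflectionPerm_self_iff, not_not]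
    simpa using hi.weylLength_mul_ofIdx_lt this

omit [Finite ι] [P.IsCrystallographic] [P.IsReduced] in
lemma weylGroupToPerm_inv_apply_self (w : P.weylGroup) (i : ι) :
    P.weylGroupToPerm w (P.weylGroupToPerm w⁻¹ i) = i := by
  rw [← Equiv.Perm.mul_apply, ← map_mul]; simp

omit [Finite ι] [P.IsCrystallographic] [P.IsReduced] in
lemma mul_ofIdx_weylGroupToPerm_inv (w : P.weylGroup) (i : ι) :
    w * weylGroup.ofIdx P (P.weylGroupToPerm w⁻¹ i) = weylGroup.ofIdx P i * w := by
  rw [ofIdx_weylGroupToPerm]; group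

lemma IsPos.weylLength_lt_ofIdx_mul_iff {i : ι} (hi : b.IsPos i) {w : P.weylGroup} :
    b.weylLength w < b.weylLength (weylGroup.ofIdx P i * w) ↔
      b.IsPos (P.weylGroupToPerm w⁻¹ i) := by
  rw [← mul_ofIdx_weylGroupToPerm_inv]
  refine ⟨fun h => ?_, fun h => ?_⟩
  · by_contra h'
    rw [← isPos_reflectionPerm_self_iff] at h'
    rw [← ofIdx_reflectionPerm_self, h'.weylLength_lt_mul_ofIdx_iff,
      weylGroupToPerm_reflectionPerm_self, weylGroupToPerm_inv_apply_self,
      isPos_reflectionPerm_self_iff] at h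
    exact h hi
  · rwa [h.weylLength_lt_mul_ofIdx_iff, weylGroupToPerm_inv_apply_self]

lemma weylLength_ofIdx_mul_ne (b : P.Base) (i : ι) (w : P.weylGroup) :
    b.weylLength (weylGroup.ofIdx P i * w) ≠ b.weylLength w := by
  wlog hi : b.IsPos i generalizing i
  · rw [← ofIdx_reflectionPerm_self]
    exact this _ ((b.isPos_reflectionPerm_self_iff i).2 hi)
  intro h
  have h₁ := hi.weylLength_lt_ofIdx_mul_iff (w := w)
  have h₂ := hi.weylLength_lt_ofIdx_mul_iff (w := weylGroup.ofIdx P i * w)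
  rw [← mul_assoc, ofIdx_mul_self, one_mul, h, mul_inv_rev, map_mul, ofIdx_inv,
    Equiv.Perm.mul_apply, weylGroupToPerm_ofIdx, weylGroupToPerm_reflectionPerm_self,
    isPos_reflectionPerm_self_iff] at h₂
  rw [h] at h₁
  tauto

lemma weylLength_mul_ofIdx_eq_or (b : P.Base) (w : P.weylGroup) {j : ι} (hj : j ∈ b.support) :
    b.weylLength (w * weylGroup.ofIdx P j) = b.weylLength w + 1 ∨
      b.weylLength w = b.weylLength (w * weylGroup.ofIdx P j) + 1 := by
  have h₁ := b.weylLength_mul_ofIdx_le w hj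
  have h₂ := b.weylLength_mul_ofIdx_le (w * weylGroup.ofIdx P j) hj
  have h₃ := b.weylLength_ofIdx_mul_ne (P.weylGroupToPerm w j) w
  rw [ofIdx_weylGroupToPerm, inv_mul_cancel_right] at h₃
  rw [mul_ofIdx_mul_ofIdx] at h₂
  lia

lemma exists_weylLength_mul_ofIdx_lt (b : P.Base) {w : P.weylGroup} (hw : b.weylLength w ≠ 0) :
    ∃ j ∈ b.support, b.weylLength (w * weylGroup.ofIdx P j) < b.weylLength w := by
  obtain ⟨l, hl, rfl⟩ := b.exists_reduced_word w
  rcases l.eq_nil_or_concat with rfl | ⟨l, j, rfl⟩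
  · simp at hl; exact absurd hl.symm hw
  · refine ⟨j, j.2, ?_⟩
    have := b.weylLength_wordProd_le l
    rw [← hl]
    simp [wordProd_append]
    lia

/-! ### Bruhat covers and right multiplication by simple reflections -/

/-- `b.Cover i x y`: the element `y` covers `x` in the Bruhat order, and the edge from `x` to
`y = s_i x` of the Bruhat graph is labelled by the positive root `i`. -/
structure Cover (b : P.Base) (i : ι) (x y : P.weylGroup) : Prop where
  isPos : b.IsPos i
  eq : y = weylGroup.ofIdx P i * x
  length : b.weylLength y = b.weylLength x + 1

/-- The simple reflection `j` is a right descent of `w`. -/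
def IsDescent (b : P.Base) (j : ι) (w : P.weylGroup) : Prop :=
  b.weylLength (w * weylGroup.ofIdx P j) < b.weylLength w

variable {i j : ι} {x y : P.weylGroup}

lemma IsDescent.length (h : b.IsDescent j x) (hj : j ∈ b.support) :
    b.weylLength x = b.weylLength (x * weylGroup.ofIdx P j) + 1 := by
  have := b.weylLength_mul_ofIdx_eq_or x hj
  unfold IsDescent at h
  lia

lemma length_of_not_isDescent (h : ¬ b.IsDescent j x) (hj : j ∈ b.support) :
    b.weylLength (x * weylGroup.ofIdx P j) = b.weylLength x + 1 := by
  have := b.weylLength_mul_ofIdx_eq_or x hj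
  unfold IsDescent at h
  lia

lemma isDescent_mul_ofIdx_iff (hj : j ∈ b.support) :
    b.IsDescent j (x * weylGroup.ofIdx P j) ↔ ¬ b.IsDescent j x := by
  have := b.weylLength_mul_ofIdx_eq_or x hj
  unfold IsDescent
  rw [mul_ofIdx_mul_ofIdx]
  lia

/-- Right multiplication by the simple reflection `j` preserves an edge `x < s_i x` of the Bruhat
graph together with its label and its direction, unless it merely flips the edge. -/
lemma IsPos.eq_mul_or_length_lt (hi : b.IsPos i) (hj : j ∈ b.support)
    (h : b.weylLength x < b.weylLength (weylGroup.ofIdx P i * x)) :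
    weylGroup.ofIdx P i * x = x * weylGroup.ofIdx P j ∨
    b.weylLength (x * weylGroup.ofIdx P j) <
      b.weylLength (weylGroup.ofIdx P i * (x * weylGroup.ofIdx P j)) := by
  rw [hi.weylLength_lt_ofIdx_mul_iff] at h ⊢
  by_cases hij : P.weylGroupToPerm x⁻¹ i = j
  · left
    rw [← hij, mul_ofIdx_weylGroupToPerm_inv]
  · right
    rw [mul_inv_rev, ofIdx_inv, map_mul, Equiv.Perm.mul_apply, weylGroupToPerm_ofIdx]
    exact h.reflectionPerm hj hij

lemma Cover.eq_mul_or_lt (h : b.Cover i x y) (hj : j ∈ b.support) :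
    y = x * weylGroup.ofIdx P j ∨
    b.weylLength (x * weylGroup.ofIdx P j) < b.weylLength (y * weylGroup.ofIdx P j) := by
  have := h.isPos.eq_mul_or_length_lt (x := x) hj (by rw [← h.eq, h.length]; lia)
  rwa [← mul_assoc, ← h.eq] at this

/-- A cover that goes from an element without the descent `j` to one with descent `j` is right
multiplication by `s_j`. -/
lemma Cover.eq_mul (h : b.Cover i x y) (hj : j ∈ b.support) (hx : ¬ b.IsDescent j x)
    (hy : b.IsDescent j y) : y = x * weylGroup.ofIdx P j := by
  refine (h.eq_mul_or_lt hj).resolve_right ?_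
  have := h.length
  have := length_of_not_isDescent hx hj
  have := hy.length hj
  lia

lemma Cover.mul_of_isDescent (h : b.Cover i x y) (hj : j ∈ b.support) (hx : b.IsDescent j x)
    (hy : b.IsDescent j y) :
    b.Cover i (x * weylGroup.ofIdx P j) (y * weylGroup.ofIdx P j) := by
  refine ⟨h.isPos, by rw [h.eq, mul_assoc], ?_⟩
  have := h.length
  have := hx.length hj
  have := hy.length hj
  lia

lemma Cover.mul_of_not_isDescent (h : b.Cover i x y) (hj : j ∈ b.support)
    (hx : ¬ b.IsDescent j x) (hy : ¬ b.IsDescent j y) :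
    b.Cover i (x * weylGroup.ofIdx P j) (y * weylGroup.ofIdx P j) := by
  refine ⟨h.isPos, by rw [h.eq, mul_assoc], ?_⟩
  have := h.length
  have := length_of_not_isDescent hx hj
  have := length_of_not_isDescent hy hj
  lia

lemma cover_mul_of_not_isDescent (hj : j ∈ b.support) (hx : ¬ b.IsDescent j x) :
    b.Cover (P.weylGroupToPerm x j) x (x * weylGroup.ofIdx P j) := by
  have h := length_of_not_isDescent hx hj
  refine ⟨?_, by rw [ofIdx_weylGroupToPerm, inv_mul_cancel_right], h⟩
  rw [← (isPos_of_mem_support hj).weylLength_lt_mul_ofIdx_iff]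
  lia

lemma IsDescent.cover (hx : b.IsDescent j x) (hj : j ∈ b.support) :
    b.Cover (P.weylGroupToPerm (x * weylGroup.ofIdx P j) j) (x * weylGroup.ofIdx P j) x := by
  have := cover_mul_of_not_isDescent (x := x * weylGroup.ofIdx P j) hj
    (by rwa [isDescent_mul_ofIdx_iff hj, not_not])
  rwa [mul_ofIdx_mul_ofIdx] at this

omit [Finite ι] [P.IsCrystallographic] [P.IsReduced] in
lemma span_root_weylGroupToPerm (x : P.weylGroup) (j : ι) :
    Submodule.span ℝ {P.root (P.weylGroupToPerm x j)} = Submodule.span ℝ {x • P.root j} := by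
  rw [weylGroup_apply_root]

omit [Finite ι] [P.IsCrystallographic] [P.IsReduced] in
lemma span_root_weylGroupToPerm_mul (x : P.weylGroup) (j : ι) :
    Submodule.span ℝ {P.root (P.weylGroupToPerm (x * weylGroup.ofIdx P j) j)} =
      Submodule.span ℝ {x • P.root j} := by
  rw [span_root_weylGroupToPerm, mul_smul, ofIdx_smul_root, smul_neg, ← Set.neg_singleton,
    Submodule.span_neg]

end Length

section Chains

/-! ### Saturated chains and the spans of their labels -/

/-- `b.Chain u v S`: there is a saturated Bruhat chain from `u` to `v` whose labels span `S`. -/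
inductive Chain (b : P.Base) (u : P.weylGroup) : P.weylGroup → Submodule ℝ M → Prop
  | refl : Chain b u u ⊥
  | snoc {x y : P.weylGroup} {i : ι} {S : Submodule ℝ M} :
      Chain b u x S → b.Cover i x y → Chain b u y (S ⊔ Submodule.span ℝ {P.root i})

variable {b : P.Base} {i j : ι} {u v x y : P.weylGroup} {S S' : Submodule ℝ M}

lemma Chain.trans (h : b.Chain u x S) (h' : b.Chain x y S') : b.Chain u y (S ⊔ S') := by
  induction h' with
  | refl => rwa [sup_bot_eq]
  | snoc _ hc ih => rw [← sup_assoc]; exact ih.snoc hc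

lemma Cover.chain (h : b.Cover i x y) : b.Chain x y (Submodule.span ℝ {P.root i}) := by
  simpa using Chain.refl.snoc h

lemma Chain.length_le (h : b.Chain u x S) : b.weylLength u ≤ b.weylLength x := by
  induction h with
  | refl => rfl
  | snoc _ hc ih => have := hc.length; lia

/-- The action of the Weyl group is constant along a chain modulo the span of its labels. -/
lemma Chain.smul_sub_smul_mem (h : b.Chain u x S) (m : M) : u • m - x • m ∈ S := by
  induction h with
  | refl => simp
  | @snoc x y i S _ hc ih =>
    have h₂ : x • m - y • m ∈ Submodule.span ℝ {P.root i} := by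
      rw [hc.eq, mul_smul]
      exact smul_sub_ofIdx_smul i (x • m)
    simpa using Submodule.add_mem_sup ih h₂

lemma sup_span_singleton_congr {V : Type*} [AddCommGroup V] [Module ℝ V] {S : Submodule ℝ V}
    {m m' : V} (h : m - m' ∈ S) :
    S ⊔ Submodule.span ℝ {m} = S ⊔ Submodule.span ℝ {m'} := by
  suffices ∀ {m m' : V}, m - m' ∈ S →
      S ⊔ Submodule.span ℝ {m} ≤ S ⊔ Submodule.span ℝ {m'} from
    le_antisymm (this h) (this (by simpa using S.neg_mem h))
  intro m m' h
  refine sup_le le_sup_left ((Submodule.span_singleton_le_iff_mem _ _).2 ?_)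
  simpa using Submodule.add_mem_sup h (Submodule.mem_span_singleton_self m')

lemma Chain.sup_span_smul (h : b.Chain u x S) (m : M) :
    S ⊔ Submodule.span ℝ {x • m} = S ⊔ Submodule.span ℝ {u • m} :=
  (sup_span_singleton_congr (h.smul_sub_smul_mem m)).symm

variable [P.IsReduced]

lemma IsPos.eq_of_root_mem_span (hi : b.IsPos i) (hj : b.IsPos j)
    (h : P.root i ∈ Submodule.span ℝ {P.root j}) : i = j := by
  by_contra hne
  obtain ⟨c, hc⟩ := Submodule.mem_span_singleton.1 h
  have hli := IsReduced.linearIndependent (P := P) hne (fun h' => by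
    have : i = P.reflectionPerm j j := P.root.injective (by simpa using h')
    exact (b.isPos_reflectionPerm_self_iff j).1 (this ▸ hi) hj)
  have := (LinearIndependent.pair_iff.1 hli) 1 (-c) (by simp [← hc])
  exact one_ne_zero this.1

lemma IsPos.eq_of_ofIdx_eq (hi : b.IsPos i) (hj : b.IsPos j)
    (h : weylGroup.ofIdx P i = weylGroup.ofIdx P j) : i = j := by
  refine hi.eq_of_root_mem_span hj ?_
  have := smul_sub_ofIdx_smul (P := P) j (P.root i)
  rw [← h, ofIdx_smul_root, sub_neg_eq_add, ← two_smul ℝ] at this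
  exact (Submodule.smul_mem_iff _ (two_ne_zero (α := ℝ))).1 this

variable [Finite ι] [P.IsCrystallographic]

lemma Cover.eq_weylGroupToPerm (h : b.Cover i x (x * weylGroup.ofIdx P j)) (hj : j ∈ b.support) :
    i = P.weylGroupToPerm x j := by
  refine h.isPos.eq_of_ofIdx_eq ?_ ?_
  · rw [← (isPos_of_mem_support hj).weylLength_lt_mul_ofIdx_iff, h.length]
    lia
  · rw [ofIdx_weylGroupToPerm, h.eq, mul_inv_cancel_right]

/-- Projecting a chain from an element `u` with descent `j` along `x ↦ min x (x s_j)`. A label is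
gained whenever the chain leaves the elements with descent `j`, and lost when it comes back to them.
Up to sign and modulo the labels seen so far, all of these labels are `u • α_j`. -/
lemma Chain.lower_of_isDescent (hj : j ∈ b.support) (hu : b.IsDescent j u)
    (h : b.Chain u x S) :
    (b.IsDescent j x →
      b.Chain (u * weylGroup.ofIdx P j) (x * weylGroup.ofIdx P j) S) ∧
    (¬ b.IsDescent j x →
      b.Chain (u * weylGroup.ofIdx P j) x (S ⊔ Submodule.span ℝ {u • P.root j})) := by
  induction h with
  | refl => exact ⟨fun _ => .refl, fun h => absurd hu h⟩
  | @snoc x y i S hx hc ih =>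
    by_cases dx : b.IsDescent j x
    · refine ⟨fun dy => (ih.1 dx).snoc (hc.mul_of_isDescent hj dx dy), fun dy => ?_⟩
      have := ((ih.1 dx).snoc (dx.cover hj)).snoc hc
      rwa [span_root_weylGroupToPerm_mul, hx.sup_span_smul, sup_right_comm] at this
    · refine ⟨fun dy => ?_, fun dy => ?_⟩
      · obtain rfl := hc.eq_mul hj dx dy
        rw [mul_ofIdx_mul_ofIdx, hc.eq_weylGroupToPerm hj, span_root_weylGroupToPerm,
          hx.sup_span_smul]
        exact ih.2 dx
      · rw [sup_right_comm]
        exact (ih.2 dx).snoc hc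

/-- Projecting a chain from an element `u` without the descent `j` to an element with descent `j`
along `x ↦ min x (x s_j)`. A label is lost when the chain first reaches the elements with descent
`j`; up to sign and modulo the labels seen so far, it is `u • α_j`. -/
lemma Chain.lower_of_not_isDescent (hj : j ∈ b.support) (hu : ¬ b.IsDescent j u)
    (h : b.Chain u x S) (hx : b.IsDescent j x) :
    ∃ S', b.Chain u (x * weylGroup.ofIdx P j) S' ∧
      S = S' ⊔ Submodule.span ℝ {u • P.root j} := by
  induction h with
  | refl => exact absurd hx hu
  | @snoc x y i S hx' hc ih =>
    by_cases dx : b.IsDescent j x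
    · obtain ⟨S', h, rfl⟩ := ih dx
      exact ⟨_, h.snoc (hc.mul_of_isDescent hj dx hx), sup_right_comm _ _ _⟩
    · obtain rfl := hc.eq_mul hj dx hx
      refine ⟨S, by rwa [mul_ofIdx_mul_ofIdx], ?_⟩
      rw [hc.eq_weylGroupToPerm hj, span_root_weylGroupToPerm, hx'.sup_span_smul]

/-- All saturated chains from `u` to `v` have the same span of labels. -/
theorem Chain.span_unique (h : b.Chain u v S) (h' : b.Chain u v S') : S = S' := by
  induction hn : b.weylLength v using Nat.strong_induction_on generalizing u v S S' with
  | _ n ih =>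
    by_cases h0 : b.weylLength v = 0
    · cases h with
      | snoc _ hc => have := hc.length; lia
      | refl =>
        cases h' with
        | snoc _ hc => have := hc.length; lia
        | refl => rfl
    obtain ⟨j, hj, hv⟩ := b.exists_weylLength_mul_ofIdx_lt h0
    by_cases hu : b.IsDescent j u
    · exact ih _ (hn ▸ hv) ((h.lower_of_isDescent hj hu).1 hv)
        ((h'.lower_of_isDescent hj hu).1 hv) rfl
    · obtain ⟨T, hT, rfl⟩ := h.lower_of_not_isDescent hj hu hv
      obtain ⟨T', hT', rfl⟩ := h'.lower_of_not_isDescent hj hu hv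
      rw [ih _ (hn ▸ hv) hT hT' rfl]

/-! ### The Bruhat order is graded -/

/-- Projecting a chain from an element `u` without the descent `j` along `x ↦ max x (x s_j)`. -/
lemma Chain.upper (hj : j ∈ b.support) (hu : ¬ b.IsDescent j u) (h : b.Chain u x S) :
    (b.IsDescent j x → ∃ S', b.Chain (u * weylGroup.ofIdx P j) x S') ∧
    (¬ b.IsDescent j x →
      ∃ S', b.Chain (u * weylGroup.ofIdx P j) (x * weylGroup.ofIdx P j) S') := by
  induction h with
  | refl => exact ⟨fun h => absurd h hu, fun _ => ⟨_, .refl⟩⟩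
  | @snoc x y i S hx hc ih =>
    by_cases dx : b.IsDescent j x
    · obtain ⟨S', h⟩ := ih.1 dx
      exact ⟨fun _ => ⟨_, h.snoc hc⟩,
        fun dy => ⟨_, (h.snoc hc).snoc (cover_mul_of_not_isDescent hj dy)⟩⟩
    · obtain ⟨S', h⟩ := ih.2 dx
      refine ⟨fun dy => ⟨S', ?_⟩, fun dy => ⟨_, h.snoc (hc.mul_of_not_isDescent hj dx dy)⟩⟩
      rwa [hc.eq_mul hj dx dy]

/-- Every upward edge of the Bruhat graph refines to a saturated chain. -/
lemma IsPos.exists_chain (hi : b.IsPos i)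
    (h : b.weylLength u < b.weylLength (weylGroup.ofIdx P i * u)) :
    ∃ S, b.Chain u (weylGroup.ofIdx P i * u) S := by
  induction hn : b.weylLength (weylGroup.ofIdx P i * u) using Nat.strong_induction_on
    generalizing u with
  | _ n ih =>
    obtain ⟨j, hj, hv⟩ := b.exists_weylLength_mul_ofIdx_lt
      (w := weylGroup.ofIdx P i * u) (by lia)
    have hlt := hi.eq_mul_or_length_lt hj h
    rw [← mul_assoc] at hlt
    have dv := IsDescent.cover (b := b) hv hj
    by_cases hu : b.IsDescent j u
    · have hlt := hlt.resolve_left fun he => by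
        unfold IsDescent at hu
        rw [he] at h
        lia
      rw [mul_assoc] at hlt hv
      obtain ⟨S, hS⟩ := ih _ (hn ▸ hv) hlt rfl
      obtain ⟨S', hS'⟩ := (hS.upper hj (by rwa [isDescent_mul_ofIdx_iff hj, not_not])).2 (by
        rw [← mul_assoc, isDescent_mul_ofIdx_iff hj, not_not, IsDescent, mul_assoc]
        exact hv)
      refine ⟨S', ?_⟩
      simpa [← mul_assoc] using hS'
    · rcases hlt with he | hlt
      · rw [he]
        exact ⟨_, (cover_mul_of_not_isDescent hj hu).chain⟩
      · rw [mul_assoc] at hlt hv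
        obtain ⟨S, hS⟩ := ih _ (hn ▸ hv) hlt rfl
        rw [← mul_assoc] at hS
        exact ⟨_, ((cover_mul_of_not_isDescent hj hu).chain.trans hS).snoc dv⟩

lemma exists_chain_ofIdx_mul (b : P.Base) (i : ι) (u : P.weylGroup)
    (h : b.weylLength u < b.weylLength (weylGroup.ofIdx P i * u)) :
    ∃ S, b.Chain u (weylGroup.ofIdx P i * u) S := by
  by_cases hi : b.IsPos i
  · exact hi.exists_chain h
  · rw [← isPos_reflectionPerm_self_iff] at hi
    rw [← ofIdx_reflectionPerm_self] at h ⊢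
    exact hi.exists_chain h

lemma Cover.bruhatStep (h : b.Cover i x y) : b.BruhatStep x y := by
  have hlt : b.weylLength x < b.weylLength y := by rw [h.length]; lia
  refine ⟨P.weylGroupToPerm x⁻¹ i, ?_, ?_, hlt⟩
  · rwa [← h.isPos.weylLength_lt_ofIdx_mul_iff, ← h.eq]
  · rw [mul_ofIdx_weylGroupToPerm_inv, h.eq]

lemma Chain.bruhatLE (h : b.Chain u v S) : b.BruhatLE u v := by
  induction h with
  | refl => exact .refl
  | snoc _ hc ih => exact ih.tail hc.bruhatStep

theorem BruhatLE.exists_chain (h : b.BruhatLE u v) : ∃ S, b.Chain u v S := by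
  unfold BruhatLE at h
  induction h with
  | refl => exact ⟨_, .refl⟩
  | @tail x y _ hs ih =>
    obtain ⟨S, hS⟩ := ih
    obtain ⟨i, -, hy, hlt⟩ := hs
    have : y = weylGroup.ofIdx P (P.weylGroupToPerm x i) * x := by
      rw [hy, ofIdx_weylGroupToPerm, inv_mul_cancel_right]
    rw [this] at hlt ⊢
    obtain ⟨S', hS'⟩ := b.exists_chain_ofIdx_mul _ x hlt
    exact ⟨_, hS.trans hS'⟩

/-! ### Intervals of length two -/

/-- The diamond property: an interval of length two has at least two elements in the middle. -/
theorem Cover.exists_ne_cover {a : P.weylGroup} (h₁ : b.Cover i x a) (h₂ : b.Cover j a y) :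
    ∃ c ≠ a, ∃ k l, b.Cover k x c ∧ b.Cover l c y := by
  induction hn : b.weylLength y using Nat.strong_induction_on generalizing i j x a y with
  | _ n ih =>
    obtain ⟨s, hs, hy⟩ := b.exists_weylLength_mul_ofIdx_lt (w := y) (by have := h₂.length; lia)
    change b.IsDescent s y at hy
    have hys : ¬ b.IsDescent s (y * weylGroup.ofIdx P s) := by
      rwa [isDescent_mul_ofIdx_iff hs, not_not]
    by_cases hx : b.IsDescent s x
    · have hxs : ¬ b.IsDescent s (x * weylGroup.ofIdx P s) := by
        rwa [isDescent_mul_ofIdx_iff hs, not_not]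
      by_cases ha : b.IsDescent s a
      · obtain ⟨c, hc, k, l, hk, hl⟩ := ih _ (hn ▸ hy) (h₁.mul_of_isDescent hs hx ha)
          (h₂.mul_of_isDescent hs ha hy) rfl
        by_cases dc : b.IsDescent s c
        · -- Then `c = x`, and the new middle element is `y s`.
          have hcx := hk.eq_mul hs hxs dc
          rw [mul_ofIdx_mul_ofIdx] at hcx
          subst hcx
          exact ⟨y * weylGroup.ofIdx P s, fun h => hys (h ▸ ha), _, _, hl, hy.cover hs⟩
        · refine ⟨c * weylGroup.ofIdx P s, fun h => hc ?_, k, l, ?_, ?_⟩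
          · rw [← h, mul_ofIdx_mul_ofIdx]
          · simpa using hk.mul_of_not_isDescent hs hxs dc
          · simpa using hl.mul_of_not_isDescent hs dc hys
      · obtain rfl := h₂.eq_mul hs ha hy
        rw [mul_ofIdx_mul_ofIdx] at hys
        obtain ⟨c, hc, k, l, hk, hl⟩ := ih _ (by have := h₂.length; lia) (hx.cover hs) h₁ rfl
        have dc : ¬ b.IsDescent s c := fun dc => hc <| by
          rw [hk.eq_mul hs hxs dc, mul_ofIdx_mul_ofIdx]
        refine ⟨c * weylGroup.ofIdx P s, ?_, k, l, ?_, hl.mul_of_not_isDescent hs dc ha⟩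
        · rintro rfl
          rw [isDescent_mul_ofIdx_iff hs, not_not] at ha
          exact dc ha
        · simpa using hk.mul_of_not_isDescent hs hxs dc
    · by_cases ha : b.IsDescent s a
      · obtain rfl := h₁.eq_mul hs hx ha
        refine ⟨y * weylGroup.ofIdx P s, fun h => hys (h ▸ ha), j, _, ?_, hy.cover hs⟩
        simpa using h₂.mul_of_isDescent hs ha hy
      · obtain rfl := h₂.eq_mul hs ha hy
        refine ⟨x * weylGroup.ofIdx P s, ?_, _, _, cover_mul_of_not_isDescent hs hx,
          h₁.mul_of_not_isDescent hs hx ha⟩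
        rintro rfl
        rw [isDescent_mul_ofIdx_iff hs, not_not] at ha
        exact hx ha

end Chains

/-! ### The algebraic span of an interval -/

section AlgebraicSpan

variable [Finite ι] [P.IsCrystallographic] [P.IsReduced]
  {b : P.Base} {i : ι} {u v x y : P.weylGroup} {S T : Submodule ℝ M}

lemma Chain.le_algebraicSpan (h : b.Chain u x T) (hx : b.BruhatLE x v) :
    T ≤ b.algebraicSpan u v := by
  induction h with
  | refl => exact bot_le
  | @snoc x y i T hc hi ih =>
    have hxv : b.BruhatLE x v := .head hi.bruhatStep hx
    refine sup_le (ih hxv) ((Submodule.span_singleton_le_iff_mem _ _).2 (Submodule.subset_span ?_))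
    refine ⟨i, hi.isPos, rfl, x, ⟨hc.bruhatLE, hxv⟩, ?_⟩
    rw [← hi.eq]
    exact ⟨hc.bruhatLE.tail hi.bruhatStep, hx⟩

omit [Finite ι] [P.IsCrystallographic] [P.IsReduced] in
/-- The label of an edge is a combination of the labels along any chain joining its ends: such a
chain gives a factorization of the reflection in that label. -/
lemma Chain.root_mem (h : b.Chain x (weylGroup.ofIdx P i * x) T) : P.root i ∈ T := by
  have := h.smul_sub_smul_mem (x⁻¹ • P.root i)
  rw [mul_smul, smul_inv_smul, ofIdx_smul_root, sub_neg_eq_add, ← two_smul ℝ] at this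
  exact (Submodule.smul_mem_iff _ (two_ne_zero (α := ℝ))).1 this

/-- The algebraic span of an interval is spanned by the labels of any of its maximal chains. -/
theorem Chain.algebraicSpan_eq (h : b.Chain u v S) : b.algebraicSpan u v = S := by
  refine le_antisymm (Submodule.span_le.2 ?_) (h.le_algebraicSpan .refl)
  rintro _ ⟨i, -, rfl, x, hx, hix⟩
  wlog hlt : b.weylLength x < b.weylLength (weylGroup.ofIdx P i * x) generalizing x
  · refine this (weylGroup.ofIdx P i * x) hix ?_ ?_
    · rwa [← mul_assoc, ofIdx_mul_self, one_mul]
    · rw [← mul_assoc, ofIdx_mul_self, one_mul]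
      exact lt_of_le_of_ne (not_lt.1 hlt) (b.weylLength_ofIdx_mul_ne i x)
  obtain ⟨S₁, h₁⟩ := hx.1.exists_chain
  obtain ⟨S₂, h₂⟩ := b.exists_chain_ofIdx_mul i x hlt
  obtain ⟨S₃, h₃⟩ := hix.2.exists_chain
  rw [SetLike.mem_coe, h.span_unique ((h₁.trans h₂).trans h₃)]
  exact le_sup_left (a := S₁ ⊔ S₂) (le_sup_right (a := S₁) h₂.root_mem)

lemma Cover.algebraicSpan_eq_sup_right (h : b.Cover i x y) (hu : b.BruhatLE u x) :
    b.algebraicSpan u y = b.algebraicSpan u x ⊔ Submodule.span ℝ {P.root i} := by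
  obtain ⟨S, hS⟩ := hu.exists_chain
  rw [hS.algebraicSpan_eq, (hS.snoc h).algebraicSpan_eq]

lemma Cover.algebraicSpan_eq_sup_left (h : b.Cover i x y) (hv : b.BruhatLE y v) :
    b.algebraicSpan x v = b.algebraicSpan y v ⊔ Submodule.span ℝ {P.root i} := by
  obtain ⟨S, hS⟩ := hv.exists_chain
  rw [hS.algebraicSpan_eq, (h.chain.trans hS).algebraicSpan_eq, sup_comm]

lemma algebraicSpan_self (b : P.Base) (u : P.weylGroup) : b.algebraicSpan u u = ⊥ :=
  Chain.refl.algebraicSpan_eq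

/-- The two sides of a diamond have the same span of labels. -/
lemma Cover.span_diamond {a c : P.weylGroup} {j k l : ι} (h₁ : b.Cover i x a) (h₂ : b.Cover j a y)
    (h₃ : b.Cover k x c) (h₄ : b.Cover l c y) :
    Submodule.span ℝ {P.root i} ⊔ Submodule.span ℝ {P.root j} =
      Submodule.span ℝ {P.root k} ⊔ Submodule.span ℝ {P.root l} :=
  (h₁.chain.snoc h₂).span_unique (h₃.chain.snoc h₄)

omit [Finite ι] [P.IsCrystallographic] in
lemma Cover.root_mem_span_iff {j : ι} {x' y' : P.weylGroup} (h : b.Cover i x y)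
    (h' : b.Cover j x' y') (hij : P.root i ∈ Submodule.span ℝ {P.root j}) : i = j :=
  h.isPos.eq_of_root_mem_span h'.isPos hij

lemma BruhatLE.length_le (h : b.BruhatLE u v) : b.weylLength u ≤ b.weylLength v := by
  obtain ⟨S, hS⟩ := h.exists_chain
  exact hS.length_le

lemma BruhatLE.eq_of_length_eq (h : b.BruhatLE u v) (hl : b.weylLength v = b.weylLength u) :
    u = v := by
  obtain ⟨S, hS⟩ := h.exists_chain
  cases hS with
  | refl => rfl
  | snoc hc hi =>
    have := hc.length_le
    have := hi.length
    lia

/-- A nontrivial interval has a coatom. -/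
lemma BruhatLE.exists_coatom (h : b.BruhatLE u v) (hne : u ≠ v) :
    ∃ i c, b.BruhatLE u c ∧ b.Cover i c v := by
  obtain ⟨S, hS⟩ := h.exists_chain
  cases hS with
  | refl => exact absurd rfl hne
  | snoc hc hi => exact ⟨_, _, hc.bruhatLE, hi⟩

/-- A nontrivial interval has an atom. -/
lemma BruhatLE.exists_atom (h : b.BruhatLE u v) (hne : u ≠ v) :
    ∃ i c, b.Cover i u c ∧ b.BruhatLE c v := by
  obtain ⟨S, hS⟩ := h.exists_chain
  induction hS with
  | refl => exact absurd rfl hne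
  | @snoc x y i S hc hi ih =>
    by_cases hx : u = x
    · exact ⟨i, y, hx ▸ hi, .refl⟩
    · obtain ⟨k, c, hk, hcx⟩ := ih hc.bruhatLE hx
      exact ⟨k, c, hk, hcx.tail hi.bruhatStep⟩

omit [Finite ι] [P.IsCrystallographic] [P.IsReduced] in
lemma algebraicSpan_mono {u' v' : P.weylGroup} (hu : b.BruhatLE u u') (hv : b.BruhatLE v' v) :
    b.algebraicSpan u' v' ≤ b.algebraicSpan u v := by
  refine Submodule.span_mono ?_
  rintro _ ⟨i, hi, rfl, x, hx, hix⟩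
  exact ⟨i, hi, rfl, x, ⟨hu.trans hx.1, hx.2.trans hv⟩, ⟨hu.trans hix.1, hix.2.trans hv⟩⟩

end AlgebraicSpan

/-! ### Removing redundant elements of a chain -/

section Dimension

variable {W V κ : Type*} [AddCommGroup V] [Module ℝ V] [FiniteDimensional ℝ V]
  {R : ℕ → W → Prop} {cov : κ → W → W → Prop} {A : W → Submodule ℝ V} {r : κ → V}

/-- Let the elements of rank `n` of a graded poset be given by `R n`, its labelled covers by `cov`,
and let `A x` be the span of the labels along the chains that end at `x`. If the dimension of `A v`
is less than the rank of `v`, then `A` does not change along some cover `c < v`.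

Given a cover `c < v` along which `A` changes, the rank of `c` is too large as well, so `A` does not
change along some `c' < c`. If `A` changed along the other side `d < v` of the diamond too, then the
label of `c' < d` would lie both in `A c'` and in the plane of the diamond. These meet only in
the line of the label of `c' < c`, so the two labels, hence `c` and `d`, would agree. -/
theorem finrank_eq_or_exists_cov
    (h0 : ∀ x, R 0 x → A x = ⊥)
    (hR : ∀ n x, R (n + 1) x → ∃ i c, R n c ∧ cov i c x)
    (hA : ∀ n c i x, R n c → cov i c x → A x = A c ⊔ Submodule.span ℝ {r i})
    (hd : ∀ n x a y i j, R n x → cov i x a → cov j a y → ∃ c ≠ a, ∃ k l,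
      R (n + 1) c ∧ cov k x c ∧ cov l c y ∧
        Submodule.span ℝ {r i} ⊔ Submodule.span ℝ {r j} =
          Submodule.span ℝ {r k} ⊔ Submodule.span ℝ {r l})
    (hu : ∀ x a c i k, cov i x a → cov k x c → r k ∈ Submodule.span ℝ {r i} → c = a)
    (n : ℕ) (v : W) (hv : R n v) :
    Module.finrank ℝ (A v) = n ∨ ∃ m i c, n = m + 1 ∧ R m c ∧ cov i c v ∧ A c = A v := by
  induction n generalizing v with
  | zero => exact .inl (by rw [h0 v hv, finrank_bot])
  | succ n ih =>
    obtain ⟨j, c, hc, hcv⟩ := hR n v hv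
    have hAv := hA n c j v hc hcv
    by_cases hj : r j ∈ A c
    · refine .inr ⟨n, j, c, rfl, hc, hcv, ?_⟩
      rwa [hAv, left_eq_sup, Submodule.span_singleton_le_iff_mem]
    have hfv := Submodule.finrank_sup_span_singleton hj
    rw [← hAv] at hfv
    rcases ih c hc with hfc | ⟨m, i, x, rfl, hx, hxc, hAx⟩
    · exact .inl (by rw [hfv, hfc])
    obtain ⟨d, hdc, k, l, hRd, hxd, hdv, hspan⟩ := hd m x c v i j hx hxc hcv
    have hAv' := hA _ d l v hRd hdv
    by_cases hl : r l ∈ A d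
    · refine .inr ⟨m + 1, l, d, rfl, hRd, hdv, ?_⟩
      rwa [hAv', left_eq_sup, Submodule.span_singleton_le_iff_mem]
    have hfv' := Submodule.finrank_sup_span_singleton hl
    rw [← hAv'] at hfv'
    -- The spaces `A x ≤ A d` have the same dimension, so `r k` lies in `A x`.
    have hAd := hA m x k d hx hxd
    have hk : r k ∈ A x := by
      have hle : A x ≤ A d := by rw [hAd]; exact le_sup_left
      rw [Submodule.eq_of_le_of_finrank_eq hle (by rw [hAx]; lia), hAd]
      exact le_sup_right (a := A x) (Submodule.mem_span_singleton_self _)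
    have hi : r i ∈ A c := by
      rw [hA m x i c hx hxc]
      exact le_sup_right (a := A x) (Submodule.mem_span_singleton_self _)
    have hk' : r k ∈ Submodule.span ℝ {r i} ⊔ Submodule.span ℝ {r j} := by
      rw [hspan]
      exact le_sup_left (a := Submodule.span ℝ {r k}) (Submodule.mem_span_singleton_self _)
    obtain ⟨_, hs, _, ht, hst⟩ := Submodule.mem_sup.1 hk'
    obtain ⟨t, rfl⟩ := Submodule.mem_span_singleton.1 ht
    obtain ⟨s, rfl⟩ := Submodule.mem_span_singleton.1 hs
    have ht0 : t = 0 := by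
      by_contra ht0
      refine hj ((Submodule.smul_mem_iff _ ht0).1 ?_)
      rw [← eq_sub_iff_add_eq'] at hst
      rw [hst]
      exact sub_mem (hAx ▸ hk) (Submodule.smul_mem _ _ hi)
    refine absurd (hu x c d i k hxc hxd ?_) hdc
    rw [← hst, ht0, zero_smul, add_zero]
    exact Submodule.smul_mem _ _ (Submodule.mem_span_singleton_self _)

omit [FiniteDimensional ℝ V] in
/-- In the situation of `finrank_eq_or_exists_cov`, going down from `v` along covers that do not
change `A` leads to some `w` such that the dimension of `A w` is the rank of `w`. -/
theorem exists_finrank_eq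
    (H : ∀ n v, R n v →
      Module.finrank ℝ (A v) = n ∨ ∃ m i c, n = m + 1 ∧ R m c ∧ cov i c v ∧ A c = A v)
    (n : ℕ) (v : W) (hv : R n v) :
    ∃ m w, R m w ∧ Module.finrank ℝ (A w) = m ∧ A w = A v ∧
      Relation.ReflTransGen (fun x y => ∃ i, cov i x y) w v := by
  induction n generalizing v with
  | zero =>
    rcases H 0 v hv with h | ⟨m, i, c, h, -⟩
    · exact ⟨0, v, hv, h, rfl, .refl⟩
    · lia
  | succ n ih =>
    rcases H _ v hv with h | ⟨m, i, c, h, hc, hcv, hA⟩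
    · exact ⟨_, v, hv, h, rfl, .refl⟩
    · obtain rfl : n = m := by lia
      obtain ⟨k, w, hw, hf, hAw, hwc⟩ := ih c hc
      exact ⟨k, w, hw, hf, hAw.trans hA, hwc.tail ⟨i, hcv⟩⟩

end Dimension

/-! ### Toric subintervals of full dimension -/

section Toric

variable [Finite ι] [P.IsCrystallographic] [P.IsReduced] {b : P.Base} {u v : P.weylGroup}

omit [Finite ι] [P.IsCrystallographic] [P.IsReduced] in
lemma finiteDimensional_weightSpace (P : RootPairing ι ℝ M N) : FiniteDimensional ℝ M := by
  have : Module.IsReflexive ℝ M := .of_isPerfPair P.toLinearMap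
  infer_instance

/-- Repeatedly passing to a coatom with the same algebraic span shrinks `[u, v]` to a toric
interval. -/
theorem BruhatLE.exists_toric_lower (huv : b.BruhatLE u v) :
    ∃ w ∈ b.bruhatInterval u v, b.IsToricInterval u w ∧
      b.algebraicDim u w = b.algebraicDim u v := by
  have := finiteDimensional_weightSpace P
  obtain ⟨m, w, ⟨huw, hm⟩, hf, hA, hwv⟩ := exists_finrank_eq
    (R := fun n x => b.BruhatLE u x ∧ b.weylLength x = b.weylLength u + n)
    (cov := b.Cover) (A := b.algebraicSpan u)
    (finrank_eq_or_exists_cov (r := P.root)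
      (fun x hx => by rw [← hx.1.eq_of_length_eq hx.2, algebraicSpan_self])
      (fun n x hx => by
        obtain ⟨i, c, hc, hi⟩ := hx.1.exists_coatom (by rintro rfl; lia)
        exact ⟨i, c, ⟨hc, by have := hi.length; lia⟩, hi⟩)
      (fun n c i x hc hi => hi.algebraicSpan_eq_sup_right hc.1)
      (fun n x a y i j hx hi hj => by
        obtain ⟨c, hca, k, l, hk, hl⟩ := hi.exists_ne_cover hj
        exact ⟨c, hca, k, l, ⟨hx.1.tail hk.bruhatStep, by have := hk.length; lia⟩, hk, hl,
          hi.span_diamond hj hk hl⟩)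
      (fun x a c i k hi hk h => by rw [hk.eq, hi.eq, hk.root_mem_span_iff hi h]))
    (b.weylLength v - b.weylLength u) v ⟨huv, by have := huv.length_le; lia⟩
  refine ⟨w, ⟨huw, hwv.lift id fun x y ⟨i, hi⟩ => hi.bruhatStep⟩, ?_, ?_⟩
  · rw [IsToricInterval, algebraicDim, hf]
    lia
  · rw [algebraicDim, hA, algebraicDim]

/-- The dual of `BruhatLE.exists_toric_lower`: the covers are reversed, and the rank of `x` is
`ℓ(v) - ℓ(x)`. -/
theorem BruhatLE.exists_toric_upper (huv : b.BruhatLE u v) :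
    ∃ w ∈ b.bruhatInterval u v, b.IsToricInterval w v ∧
      b.algebraicDim w v = b.algebraicDim u v := by
  have := finiteDimensional_weightSpace P
  obtain ⟨m, w, ⟨hwv, hm⟩, hf, hA, huw⟩ := exists_finrank_eq
    (R := fun n x => b.BruhatLE x v ∧ b.weylLength v = b.weylLength x + n)
    (cov := fun i x y => b.Cover i y x) (A := fun x => b.algebraicSpan x v)
    (finrank_eq_or_exists_cov (r := P.root)
      (fun x hx => by rw [hx.1.eq_of_length_eq hx.2, algebraicSpan_self])
      (fun n x hx => by
        obtain ⟨i, c, hi, hc⟩ := hx.1.exists_atom (by rintro rfl; lia)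
        exact ⟨i, c, ⟨hc, by have := hi.length; lia⟩, hi⟩)
      (fun n c i x hc hi => hi.algebraicSpan_eq_sup_left hc.1)
      (fun n x a y i j hx hi hj => by
        obtain ⟨c, hca, k, l, hk, hl⟩ := hj.exists_ne_cover hi
        refine ⟨c, hca, l, k, ⟨.head hl.bruhatStep hx.1, by have := hl.length; lia⟩, hl, hk, ?_⟩
        rw [sup_comm, hj.span_diamond hi hk hl, sup_comm])
      (fun x a c i k hi hk h => by
        refine mul_left_cancel (a := weylGroup.ofIdx P i) ?_
        rw [← hi.eq, ← hk.root_mem_span_iff hi h, ← hk.eq]))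
    (b.weylLength v - b.weylLength u) u ⟨huv, by have := huv.length_le; lia⟩
  refine ⟨w, ⟨?_, hwv⟩, ?_, ?_⟩
  · exact huw.swap.lift id fun x y ⟨i, hi⟩ => hi.bruhatStep
  · rw [IsToricInterval, algebraicDim, hf]
    lia
  · rw [algebraicDim, hA, algebraicDim]

end Toric

end RootPairing.Base

end

theorem mainTheorem8 {ι M N : Type*} [Finite ι]
    [AddCommGroup M] [Module ℝ M] [AddCommGroup N] [Module ℝ N]
    (P : RootPairing ι ℝ M N) [P.IsCrystallographic] [P.IsReduced] (b : P.Base)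
    (u v : P.weylGroup) (huv : b.BruhatLE u v) :
    IsGreatest
      {d : ℤ | ∃ w ∈ b.bruhatInterval u v, b.IsToricInterval u w ∧
        d = (b.weylLength w : ℤ) - (b.weylLength u : ℤ)}
      (b.algebraicDim u v : ℤ) ∧
    IsGreatest
      {d : ℤ | ∃ w ∈ b.bruhatInterval u v, b.IsToricInterval w v ∧
        d = (b.weylLength v : ℤ) - (b.weylLength w : ℤ)}
      (b.algebraicDim u v : ℤ) := by
  have := RootPairing.Base.finiteDimensional_weightSpace P
  refine ⟨⟨?_, ?_⟩, ⟨?_, ?_⟩⟩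
  · obtain ⟨w, hw, ht, hd⟩ := huv.exists_toric_lower
    exact ⟨w, hw, ht, by rw [← hd, ht]⟩
  · rintro _ ⟨w, hw, ht, rfl⟩
    rw [← ht, Nat.cast_le]
    exact Submodule.finrank_mono (RootPairing.Base.algebraicSpan_mono .refl hw.2)
  · obtain ⟨w, hw, ht, hd⟩ := huv.exists_toric_upper
    exact ⟨w, hw, ht, by rw [← hd, ht]⟩
  · rintro _ ⟨w, hw, ht, rfl⟩
    rw [← ht, Nat.cast_le]
    exact Submodule.finrank_mono (RootPairing.Base.algebraicSpan_mono hw.1 .refl)
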